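/- Let $A$ be a commutative ring and let $E=E\bigl(\coprod_{\mathfrak m}A/\mathfrak m\bigr)$ be the injective envelope of the coproduct of the simple $A$-modules $A/\mathfrak m$, where $\mathfrak m$ runs through the maximal ideals of $A$. Let $\Lambda$ be an associative unital $A$-algebra. For a left (right) $\Lambda$-module $M$ the Matlis dual $M^\vee=\operatorname{Hom}_A(M,E)$ is a right (left) $\Lambda$-module. A left $\Lambda$-module $M$ is called Matlis reflexive if the evaluation map $M\to (M^\vee)^\vee$, $x\mapsto (f\mapsto f(x))$, is an isomorphism of $\Lambda$-modules; right $\Lambda$-modules are treated as left modules over $\Lambda^{\mathrm{op}}$. Then the Matlis reflexive $\Lambda$-modules form a Serre subcategory of the category of $\Lambda$-modules, i.e. the zero module is reflexive and for every exact sequence $0\to M'\to M\to M''\to 0$ of $\Lambda$-modules, $M$ is Matlis reflexive if and only if $M'$ and $M''$ are Matlis reflexive. Moreover this subcategory is Krull–Schmidt: every Matlis reflexive $\Lambda$-module $M$ is isomorphic to a finite direct sum $\bigoplus_{i=1}^n Y_i$ of indecomposable Matlis reflexive $\Lambda$-modules $Y_i$ with local endomorphism rings, and this decomposition is essentially unique: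 if $M\cong\bigoplus_{i=1}^m Y_i\cong\bigoplus_{j=1}^n Z_j$ with all $Y_i$ and $Z_j$ indecomposable, then there is a bijection $\sigma\colon\{1,\dots,m\}\to\{1,\dots,n\}$ with $Y_i\cong Z_{\sigma(i)}$ for all $i$. -/

import Mathlib

open CategoryTheory CategoryTheory.Limits

universe u v w

/-! ### Injective envelopes -/

/-- `i : S → E` exhibits `E` as an injective envelope of `S`: the module `E` is injective, `i` is a
monomorphism, and it is essential, i.e. every submodule of `E` meeting the image of `i` trivially
is zero. -/
structure IsInjectiveEnvelope {A : Type u} [Ring A] {S E : Type u} [AddCommGroup S] [Module A S]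
    [AddCommGroup E] [Module A E] (i : S →ₗ[A] E) : Prop where
  module_injective : Module.Injective A E
  injective : Function.Injective i
  essential : ∀ N : Submodule A E, N ⊓ LinearMap.range i = ⊥ → N = ⊥

/-- Every module over every ring has an injective envelope. -/
theorem exists_isInjectiveEnvelope (A : Type u) [Ring A] (S : Type u) [AddCommGroup S]
    [Module A S] : ∃ (E : ModuleCat.{u} A) (i : S →ₗ[A] E), IsInjectiveEnvelope i := by
  obtain ⟨I, hI, f, hf⟩ : ∃ (I : ModuleCat.{u} A) (_ : Module.Injective A I) (f : S →ₗ[A] I),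
      Function.Injective f := by
    refine ⟨Injective.under (ModuleCat.of A S), ?_, (Injective.ι (ModuleCat.of A S)).hom, ?_⟩
    · rw [Module.injective_iff_injective_object]
      exact Injective.injective_under (ModuleCat.of A S)
    · exact (ModuleCat.mono_iff_injective _).1 inferInstance
  let T : Submodule A I := LinearMap.range f
  obtain ⟨P, -, hP⟩ := zorn_le_nonempty₀
    {P : Submodule A I | T ≤ P ∧ ∀ N ≤ P, N ⊓ T = ⊥ → N = ⊥} (by
      intro c hc hchain y hy
      refine ⟨sSup c, ⟨(hc hy).1.trans (le_sSup hy), ?_⟩, fun z hz ↦ le_sSup hz⟩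
      intro N hN hNT
      rw [eq_bot_iff]
      intro x hx
      obtain ⟨Q, hQ, hxQ⟩ :=
        (Submodule.mem_sSup_of_directed ⟨y, hy⟩ hchain.directedOn).1 (hN hx)
      have := (hc hQ).2 (N ⊓ Q) inf_le_right (by
        rw [eq_bot_iff, ← hNT]
        exact inf_le_inf_right _ inf_le_left)
      rw [← this]
      exact ⟨hx, hxQ⟩) T ⟨le_rfl, fun N hN h ↦ by rwa [inf_eq_left.2 hN] at h⟩
  obtain ⟨K, -, hK⟩ := zorn_le_nonempty₀ {K : Submodule A I | Disjoint P K} (by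
      intro c hc hchain y hy
      refine ⟨sSup c, ?_, fun z hz ↦ le_sSup hz⟩
      exact hchain.directedOn.disjoint_sSup_right.2 fun z hz ↦ hc hz) ⊥ disjoint_bot_right
  have hPK : Disjoint P K := hK.prop
  obtain ⟨h, hh⟩ := hI.out (K.mkQ ∘ₗ P.subtype) (by
    rw [← LinearMap.ker_eq_bot, LinearMap.ker_comp, Submodule.ker_mkQ]
    exact Submodule.disjoint_iff_comap_eq_bot.1 hPK) P.subtype
  let r : I →ₗ[A] I := h ∘ₗ K.mkQ
  have hrP : ∀ x ∈ P, r x = x := fun x hx ↦ hh ⟨x, hx⟩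
  have hrK : ∀ x ∈ K, r x = 0 := fun x hx ↦ by
    have : K.mkQ x = 0 := by simpa using hx
    simp only [r, LinearMap.comp_apply, this, map_zero]
  have hPr : P ≤ LinearMap.range r := fun x hx ↦ ⟨x, hrP x hx⟩
  have hrange : LinearMap.range r ≤ P := by
    refine hP.2 ⟨hP.prop.1.trans hPr, fun N hN hNT ↦ ?_⟩ hPr
    have hNP : N ⊓ P = ⊥ := hP.prop.2 _ inf_le_right (by
      rw [eq_bot_iff, ← hNT]
      exact inf_le_inf_right _ inf_le_left)
    have hle : N.comap r ≤ K := by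
      refine hK.2 (y := N.comap r) ?_ fun x hx ↦ ?_
      · refine Submodule.disjoint_def.2 fun x hxP hx ↦ ?_
        rw [Submodule.mem_comap, hrP x hxP] at hx
        have : x ∈ N ⊓ P := ⟨hx, hxP⟩
        rwa [hNP] at this
      · rw [Submodule.mem_comap, hrK x hx]
        exact N.zero_mem
    rw [eq_bot_iff]
    intro x hx
    obtain ⟨y, rfl⟩ := hN hx
    exact hrK y (hle hx)
  refine ⟨ModuleCat.of A P, f.codRestrict P fun x ↦ hP.prop.1 ⟨x, rfl⟩, ⟨?_⟩, ?_, ?_⟩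
  · intro X Y _ _ _ _ g hg k
    obtain ⟨l, hl⟩ := hI.out g hg (P.subtype ∘ₗ k)
    refine ⟨(r ∘ₗ l).codRestrict P fun y ↦ hrange ⟨l y, rfl⟩, fun x ↦ Subtype.ext ?_⟩
    change r (l (g x)) = k x
    rw [hl]
    exact hrP _ (k x).2
  · exact fun x y hxy ↦ hf (congrArg Subtype.val hxy)
  · intro N hN
    have := hP.prop.2 (N.map P.subtype) (Submodule.map_subtype_le P N) (by
      rw [eq_bot_iff]
      rintro _ ⟨⟨x, hx, rfl⟩, ⟨s, hs⟩⟩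
      have hx' : x ∈ N ⊓ LinearMap.range (f.codRestrict P fun x ↦ hP.prop.1 ⟨x, rfl⟩) :=
        ⟨hx, s, Subtype.ext hs⟩
      rw [hN, Submodule.mem_bot] at hx'
      simp [hx'])
    rw [eq_bot_iff]
    intro x hx
    have hx' : (x : I) ∈ N.map P.subtype := ⟨x, hx, rfl⟩
    rw [this, Submodule.mem_bot] at hx'
    exact Subtype.ext hx'

namespace Matlis

/-! ### Matlis duality -/

/-- The coproduct of a representative set of simple modules over a commutative ring `A`, that is,
the direct sum of the residue fields `A ⧸ 𝔪`, where `𝔪` runs through the maximal ideals of `A`. -/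
abbrev SimpleSum (A : Type u) [CommRing A] : Type u :=
  DirectSum (MaximalSpectrum A) fun m ↦ A ⧸ m.asIdeal

/-- The minimal injective cogenerator `E = E(∐ A ⧸ 𝔪)` of the category of `A`-modules: an injective
envelope of the coproduct of the simple `A`-modules (unique up to isomorphism). -/
noncomputable def E (A : Type u) [CommRing A] : ModuleCat.{u} A :=
  (exists_isInjectiveEnvelope A (SimpleSum A)).choose

/-- The canonical map `∐ A ⧸ 𝔪 → E`. -/
noncomputable def toE (A : Type u) [CommRing A] : SimpleSum A →ₗ[A] E A :=
  (exists_isInjectiveEnvelope A (SimpleSum A)).choose_spec.choose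

/-- `E` is an injective envelope of `∐ A ⧸ 𝔪`. -/
theorem isInjectiveEnvelope_toE (A : Type u) [CommRing A] : IsInjectiveEnvelope (toE A) :=
  (exists_isInjectiveEnvelope A (SimpleSum A)).choose_spec.choose_spec

/-- The Matlis dual `M^∨ = Hom_A(M, E)`. -/
def Dual (A : Type u) [CommRing A] (M : Type v) [AddCommGroup M] [Module A M] : Type (max u v) :=
  M →ₗ[A] E A

section Dual

variable (A : Type u) [CommRing A] (Λ : Type w) [Ring Λ] [Algebra A Λ]
  (M : Type v) [AddCommGroup M] [Module A M]

noncomputable instance : AddCommGroup (Dual A M) := inferInstanceAs (AddCommGroup (M →ₗ[A] E A))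

noncomputable instance : Module A (Dual A M) := inferInstanceAs (Module A (M →ₗ[A] E A))

instance : FunLike (Dual A M) M (E A) := inferInstanceAs (FunLike (M →ₗ[A] E A) M (E A))

instance : LinearMapClass (Dual A M) A M (E A) :=
  inferInstanceAs (LinearMapClass (M →ₗ[A] E A) A M (E A))

variable {A M} in
@[ext] theorem Dual.ext {f g : Dual A M} (h : ∀ x, f x = g x) : f = g := LinearMap.ext h

/-- The dual of a left `Λ`-module is a right `Λ`-module (a module over `Λᵐᵒᵖ`),
via `(f · a)(x) = f (a x)`. -/
noncomputable instance rightModuleDual [Module Λ M] [IsScalarTower A Λ M] :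
    Module Λᵐᵒᵖ (Dual A M) where
  smul a f := LinearMap.comp f (Algebra.lsmul A A M a.unop)
  one_smul f := Dual.ext fun x ↦ congrArg f (one_smul Λ x)
  mul_smul a b f := Dual.ext fun x ↦ congrArg f (mul_smul b.unop a.unop x)
  smul_zero _ := Dual.ext fun _ ↦ rfl
  smul_add _ _ _ := Dual.ext fun _ ↦ rfl
  add_smul a b f := Dual.ext fun x ↦
    (congrArg f (add_smul a.unop b.unop x)).trans (map_add f _ _)
  zero_smul f := Dual.ext fun x ↦ (congrArg f (zero_smul Λ x)).trans (map_zero f)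

instance [Module Λ M] [IsScalarTower A Λ M] : IsScalarTower A Λᵐᵒᵖ (Dual A M) where
  smul_assoc c a f := Dual.ext fun x ↦
    (congrArg f (smul_assoc c a.unop x)).trans (map_smul f c _)

/-- The dual of a right `Λ`-module is a left `Λ`-module, via `(a · f)(x) = f (x a)`. -/
noncomputable instance leftModuleDual [Module Λᵐᵒᵖ M] [IsScalarTower A Λᵐᵒᵖ M] :
    Module Λ (Dual A M) where
  smul a f := LinearMap.comp f (Algebra.lsmul A A M (MulOpposite.op a))
  one_smul f := Dual.ext fun x ↦ congrArg f (one_smul Λᵐᵒᵖ x)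
  mul_smul a b f := Dual.ext fun x ↦
    congrArg f (mul_smul (MulOpposite.op b) (MulOpposite.op a) x)
  smul_zero _ := Dual.ext fun _ ↦ rfl
  smul_add _ _ _ := Dual.ext fun _ ↦ rfl
  add_smul a b f := Dual.ext fun x ↦
    (congrArg f (add_smul (MulOpposite.op a) (MulOpposite.op b) x)).trans (map_add f _ _)
  zero_smul f := Dual.ext fun x ↦ (congrArg f (zero_smul Λᵐᵒᵖ x)).trans (map_zero f)

/-- The evaluation map `M → (M^∨)^∨`, `x ↦ (f ↦ f x)`, a morphism of left `Λ`-modules. -/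
noncomputable def evaluation [Module Λ M] [IsScalarTower A Λ M] :
    M →ₗ[Λ] Dual A (Dual A M) where
  toFun x := LinearMap.applyₗ (R := A) (M := M) (M₂ := E A) x
  map_add' x y := Dual.ext fun f ↦ map_add f x y
  map_smul' _ _ := rfl

/-- A left `Λ`-module is Matlis reflexive if the evaluation map `M → (M^∨)^∨` is an isomorphism. -/
def IsReflexive [Module Λ M] [IsScalarTower A Λ M] : Prop :=
  Function.Bijective (evaluation A Λ M)

end Dual

/-- The full subcategory of Matlis reflexive modules in the category of `Λ`-modules. Here `A` acts
on a `Λ`-module by restriction of scalars along `A → Λ`. -/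
def reflexiveModules (A : Type u) [CommRing A] (Λ : Type w) [Ring Λ] [Algebra A Λ] :
    ObjectProperty (ModuleCat.{v} Λ) := fun M ↦
  letI : Module A M := Module.restrictScalars A Λ M
  haveI : IsScalarTower A Λ M := IsScalarTower.restrictScalars A Λ M
  IsReflexive A Λ M

end Matlis

/-! ### Krull–Schmidt subcategories -/

/-- A full subcategory `P` of an additive category is Krull–Schmidt if every object of `P` admits an
essentially unique decomposition into finitely many indecomposable objects (belonging to `P`) with
local endomorphism rings. -/
structure IsKrullSchmidt {C : Type u} [Category.{v} C] [Preadditive C] [HasFiniteBiproducts C]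
    [HasBinaryBiproducts C] (P : ObjectProperty C) : Prop where
  exists_decomposition : ∀ X : C, P X → ∃ (n : ℕ) (Y : Fin n → C),
    Nonempty (X ≅ ⨁ Y) ∧ ∀ i, P (Y i) ∧ Indecomposable (Y i) ∧ IsLocalRing (End (Y i))
  unique_decomposition : ∀ X : C, P X → ∀ (m n : ℕ) (Y : Fin m → C) (Z : Fin n → C),
    (∀ i, Indecomposable (Y i)) → (∀ j, Indecomposable (Z j)) →
    Nonempty (X ≅ ⨁ Y) → Nonempty (X ≅ ⨁ Z) →
    ∃ σ : Fin m ≃ Fin n, ∀ i, Nonempty (Y i ≅ Z (σ i))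

namespace Matlis

/-! ### Reflexivity, Serre closure properties and linear compactness. -/

section Reflexive

variable {A : Type u} [CommRing A]

/-! Since `E` is an injective cogenerator, evaluation into the double dual is always injective, so
reflexivity only asks that every functional on the dual be an evaluation. This concerns the
underlying `A`-module alone, and injectivity of `E` makes it pass to submodules, quotients and
extensions. Nearly every functional needed is built by `exists_linearMap_of_graph`.

Existence of decompositions rests on linear compactness (`EvaluationSurjective.exists_sub_mem`):
compatible congruences along a descending sequence of submodules have a common solution. Hence a
reflexive module contains no infinite direct sum of nonzero submodules, and repeated splitting must
stop.

Local endomorphism rings come from duality: for reflexive `M`, `End_Λ(M) ≅ Hom_Λ(M, M^∨∨) ≅ (M^∨ ⊗_Λ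
M)^∨` (`EvaluationSurjective.exists_end_addEquiv`). In a ring that is a dual, solution sets of
linear relations behave like closed sets in a compact space, so the Ellis–Numakura argument yields
idempotents, hence the exchange property (`exists_idempotent_mul`). If `M` is indecomposable, the
only idempotents are 0 and 1, and exchange makes the ring local. Uniqueness is then Azumaya's
theorem (`exists_equiv_of_biproduct_iso`). -/

theorem baer_E (A : Type u) [CommRing A] : Module.Baer A (E A) :=
  Module.Baer.of_injective (isInjectiveEnvelope_toE A).module_injective

/-- A relation between a module and `E` that is single-valued at `0` extends to a linear map. -/
theorem exists_linearMap_of_graph {T : Type v} [AddCommGroup T] [Module A T]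
    (G : Submodule A (T × E A)) (hG : ∀ e, ((0 : T), e) ∈ G → e = 0) :
    ∃ φ : T →ₗ[A] E A, ∀ p ∈ G, φ p.1 = p.2 := by
  have hG' : ∀ x ∈ G, x.1 = 0 → x.2 = 0 := by
    rintro ⟨t, e⟩ hx rfl
    exact hG e hx
  obtain ⟨φ, hφ⟩ := (baer_E A).extension_property G.toLinearPMap.domain.subtype
    (Submodule.injective_subtype _) G.toLinearPMap.toFun
  refine ⟨φ, fun p hp ↦ ?_⟩
  have hd : p.1 ∈ G.map (LinearMap.fst A T (E A)) := ⟨p, hp, rfl⟩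
  have h1 : φ p.1 = G.toLinearPMap ⟨p.1, hd⟩ := LinearMap.congr_fun hφ ⟨p.1, hd⟩
  have h2 := G.sub_mem (G.mem_graph_toLinearPMap hG' ⟨p.1, hd⟩) hp
  rw [h1, ← sub_eq_zero]
  exact hG' _ h2 (sub_self _)

theorem exists_extend {M : Type v} {N : Type w} [AddCommGroup M] [Module A M] [AddCommGroup N]
    [Module A N] (i : M →ₗ[A] N) (hi : Function.Injective i) (g : M →ₗ[A] E A) :
    ∃ f : N →ₗ[A] E A, ∀ x, f (i x) = g x := by
  obtain ⟨f, hf⟩ := exists_linearMap_of_graph (LinearMap.range (i.prod g)) (by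
    rintro e ⟨x, hx⟩
    obtain ⟨h1, rfl⟩ := Prod.ext_iff.1 hx
    have : x = 0 := hi (h1.trans (map_zero i).symm)
    simp [this])
  exact ⟨f, fun x ↦ hf _ ⟨x, rfl⟩⟩

theorem exists_functional_of_isMaximal {m : Ideal A} (hm : m.IsMaximal) :
    ∃ g : A →ₗ[A] E A, (∀ a ∈ m, g a = 0) ∧ g 1 ≠ 0 := by
  classical
  let j : (A ⧸ m) →ₗ[A] SimpleSum A :=
    DirectSum.lof A (MaximalSpectrum A) (fun m ↦ A ⧸ m.asIdeal) ⟨m, hm⟩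
  have hj : Function.Injective j :=
    DirectSum.of_injective (β := fun m : MaximalSpectrum A ↦ A ⧸ m.asIdeal) ⟨m, hm⟩
  refine ⟨toE A ∘ₗ j ∘ₗ m.mkQ, fun a ha ↦ ?_, fun h ↦ ?_⟩
  · have : m.mkQ a = 0 := (Submodule.Quotient.mk_eq_zero m).2 ha
    rw [LinearMap.comp_apply, LinearMap.comp_apply, this, map_zero, map_zero]
  · rw [LinearMap.comp_apply, LinearMap.comp_apply] at h
    have h2 : j (m.mkQ 1) = 0 :=
      (isInjectiveEnvelope_toE A).injective (h.trans (map_zero (toE A)).symm)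
    have h3 : m.mkQ 1 = 0 := hj (h2.trans (map_zero j).symm)
    exact hm.ne_top ((Ideal.eq_top_iff_one m).2 ((Submodule.Quotient.mk_eq_zero m).1 h3))

/-- `E` is a cogenerator. -/
theorem exists_apply_ne_zero {M : Type v} [AddCommGroup M] [Module A M] {x : M} (hx : x ≠ 0) :
    ∃ f : M →ₗ[A] E A, f x ≠ 0 := by
  let I : Ideal A := LinearMap.ker (LinearMap.toSpanSingleton A M x)
  have hI : I ≠ ⊤ := fun h ↦ hx <| by
    have : (1 : A) ∈ I := h ▸ Submodule.mem_top
    simpa [I] using this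
  obtain ⟨m, hm, hIm⟩ := Ideal.exists_le_maximal I hI
  obtain ⟨g, hg, hg1⟩ := exists_functional_of_isMaximal hm
  -- The assignment `a • x ↦ g a` is well defined because `g` kills `m`, which contains the
  -- annihilator `I` of `x`.
  obtain ⟨f, hf⟩ := exists_linearMap_of_graph
    (LinearMap.range ((LinearMap.toSpanSingleton A M x).prod g)) (by
      rintro e ⟨a, ha⟩
      obtain ⟨h1, rfl⟩ := Prod.ext_iff.1 ha
      exact hg a (hIm h1))
  refine ⟨f, fun h0 ↦ hg1 ?_⟩
  have h1 : f ((1 : A) • x) = g 1 := hf _ ⟨1, rfl⟩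
  rw [← h1, one_smul, h0]

theorem exists_apply_ne_zero_of_notMem {M : Type v} [AddCommGroup M] [Module A M]
    {V : Submodule A M} {x : M} (hx : x ∉ V) :
    ∃ f : M →ₗ[A] E A, (∀ y ∈ V, f y = 0) ∧ f x ≠ 0 := by
  obtain ⟨f, hf⟩ := exists_apply_ne_zero (A := A) (x := V.mkQ x)
    (fun h ↦ hx ((Submodule.Quotient.mk_eq_zero V).1 h))
  refine ⟨f ∘ₗ V.mkQ, fun y hy ↦ ?_, hf⟩
  have : V.mkQ y = 0 := (Submodule.Quotient.mk_eq_zero V).2 hy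
  rw [LinearMap.comp_apply, this, map_zero]

/-- Every functional on the dual is given by evaluation at an element. -/
def EvaluationSurjective (A : Type u) [CommRing A] (M : Type v) [AddCommGroup M] [Module A M] :
    Prop :=
  ∀ ξ : (M →ₗ[A] E A) →ₗ[A] E A, ∃ x, ∀ f, ξ f = f x

/-- Injectivity of evaluation is automatic, `E` being a cogenerator; no trace of the action of `Λ`
remains. -/
theorem isReflexive_iff {Λ : Type w} [Ring Λ] [Algebra A Λ] {M : Type v} [AddCommGroup M]
    [Module A M] [Module Λ M] [IsScalarTower A Λ M] :
    IsReflexive A Λ M ↔ EvaluationSurjective A M := by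
  constructor
  · intro h ξ
    obtain ⟨x, hx⟩ := h.2 ξ
    exact ⟨x, fun f ↦ (DFunLike.congr_fun hx f).symm⟩
  · refine fun h ↦ ⟨fun x y hxy ↦ ?_, fun ξ ↦ ?_⟩
    · by_contra hne
      obtain ⟨f, hf⟩ := exists_apply_ne_zero (A := A) (sub_ne_zero.2 hne)
      refine hf ?_
      rw [map_sub, sub_eq_zero]
      exact DFunLike.congr_fun hxy f
    · obtain ⟨x, hx⟩ := h ξ
      exact ⟨x, Dual.ext fun f ↦ (hx f).symm⟩

variable {M₁ M₂ M₃ : Type v} [AddCommGroup M₁] [AddCommGroup M₂] [AddCommGroup M₃]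
  [Module A M₁] [Module A M₂] [Module A M₃]

/-- Precomposed with restriction along `i`, `ξ` becomes evaluation at some `x` in `M₂`. It vanishes
on functionals killing the image of `i`, and these separate that image from any point outside it, so
`x` comes from `M₁`. -/
theorem EvaluationSurjective.of_injective (h : EvaluationSurjective A M₂) (i : M₁ →ₗ[A] M₂)
    (hi : Function.Injective i) : EvaluationSurjective A M₁ := by
  intro ξ
  obtain ⟨x, hx⟩ := h (ξ ∘ₗ LinearMap.lcomp A (E A) i)
  have hxi : x ∈ LinearMap.range i := by
    by_contra hn
    obtain ⟨f, hf, hfx⟩ := exists_apply_ne_zero_of_notMem hn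
    refine hfx ?_
    have : f ∘ₗ i = 0 := LinearMap.ext fun y ↦ hf _ ⟨y, rfl⟩
    rw [← hx]
    change ξ (f ∘ₗ i) = 0
    rw [this, map_zero]
  obtain ⟨y, rfl⟩ := hxi
  refine ⟨y, fun g ↦ ?_⟩
  obtain ⟨f, hf⟩ := exists_extend i hi g
  have : f ∘ₗ i = g := LinearMap.ext hf
  rw [← hf, ← hx]
  change _ = ξ (f ∘ₗ i)
  rw [this]

/-- The dual of `p` embeds the dual of `M₃` into that of `M₂`, so `ξ` extends along it. -/
theorem EvaluationSurjective.of_surjective (h : EvaluationSurjective A M₂) (p : M₂ →ₗ[A] M₃)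
    (hp : Function.Surjective p) : EvaluationSurjective A M₃ := by
  intro ξ
  obtain ⟨ξ', hξ'⟩ := exists_extend (LinearMap.lcomp A (E A) p)
    (fun f g hfg ↦ LinearMap.ext fun y ↦ by
      obtain ⟨x, rfl⟩ := hp y
      exact LinearMap.congr_fun hfg x) ξ
  obtain ⟨x, hx⟩ := h ξ'
  exact ⟨p x, fun f ↦ by rw [← hξ', hx]; rfl⟩

theorem EvaluationSurjective.of_exact (h₁ : EvaluationSurjective A M₁)
    (h₃ : EvaluationSurjective A M₃) (i : M₁ →ₗ[A] M₂) (p : M₂ →ₗ[A] M₃)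
    (hp : Function.Surjective p) (hip : Function.Exact i p) : EvaluationSurjective A M₂ := by
  intro ξ
  obtain ⟨z, hz⟩ := h₃ (ξ ∘ₗ LinearMap.lcomp A (E A) p)
  obtain ⟨x, rfl⟩ := hp z
  -- After correcting by evaluation at `x`, `ξ` vanishes on functionals that factor through `p`. By
  -- exactness these are the ones with `f ∘ₗ i = 0`, so the correction descends to a functional of
  -- `f ∘ₗ i`.
  obtain ⟨ξ', hξ'⟩ := exists_linearMap_of_graph
    (LinearMap.range ((LinearMap.lcomp A (E A) i).prod (ξ - LinearMap.applyₗ (R := A) x))) (by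
      rintro e ⟨f, hf⟩
      obtain ⟨h1, rfl⟩ := Prod.ext_iff.1 hf
      obtain ⟨g, hg⟩ := exists_linearMap_of_graph (LinearMap.range (p.prod f)) (by
        rintro e ⟨y, hy⟩
        obtain ⟨h2, rfl⟩ := Prod.ext_iff.1 hy
        obtain ⟨w, rfl⟩ := (hip y).1 h2
        exact LinearMap.congr_fun h1 w)
      have hgf : g ∘ₗ p = f := LinearMap.ext fun y ↦ hg _ ⟨y, rfl⟩
      change ξ f - f x = 0
      rw [← hgf, sub_eq_zero]
      exact hz g)
  obtain ⟨y, hy⟩ := h₁ ξ'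
  refine ⟨x + i y, fun f ↦ ?_⟩
  have h1 : ξ' (f ∘ₗ i) = ξ f - f x := hξ' _ ⟨f, rfl⟩
  have h2 : ξ' (f ∘ₗ i) = f (i y) := hy _
  rw [map_add, ← h2, h1]
  abel

/-- Countable linear compactness of reflexive modules. -/
theorem EvaluationSurjective.exists_sub_mem (h : EvaluationSurjective A M₁)
    (V : ℕ → Submodule A M₁) (hV : Antitone V) (s : ℕ → M₁)
    (hs : ∀ m n, m ≤ n → s n - s m ∈ V m) : ∃ x, ∀ n, x - s n ∈ V n := by
  -- `G n` is the graph of `f ↦ f (s n)` on the annihilator of `V n`. The annihilators increase and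
  -- the compatibility of `s` makes the evaluations agree, so the union is single-valued and extends
  -- to some `ξ`; the point representing `ξ` is the required limit.
  let G : ℕ → Submodule A ((M₁ →ₗ[A] E A) × E A) := fun n ↦
    { carrier := {p | (∀ y ∈ V n, p.1 y = 0) ∧ p.1 (s n) = p.2}
      zero_mem' := ⟨fun y _ ↦ rfl, rfl⟩
      add_mem' := fun {p q} hp hq ↦
        ⟨fun y hy ↦ (congrArg₂ (· + ·) (hp.1 y hy) (hq.1 y hy)).trans (add_zero _),
          congrArg₂ (· + ·) hp.2 hq.2⟩
      smul_mem' := fun a p hp ↦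
        ⟨fun y hy ↦ (congrArg (a • ·) (hp.1 y hy)).trans (smul_zero _), congrArg (a • ·) hp.2⟩ }
  have hG : Monotone G := fun m n hmn p hp ↦ by
    refine ⟨fun y hy ↦ hp.1 y (hV hmn hy), ?_⟩
    rw [← hp.2, ← sub_eq_zero, ← map_sub]
    exact hp.1 _ (hs m n hmn)
  obtain ⟨ξ, hξ⟩ := exists_linearMap_of_graph (⨆ n, G n) (by
    intro e he
    obtain ⟨n, hn⟩ := (Submodule.mem_iSup_of_directed G hG.directed_le).1 he
    exact hn.2.symm)
  obtain ⟨x, hx⟩ := h ξ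
  refine ⟨x, fun n ↦ ?_⟩
  by_contra hn
  obtain ⟨f, hf, hfx⟩ := exists_apply_ne_zero_of_notMem hn
  refine hfx ?_
  rw [map_sub, sub_eq_zero, ← hx]
  exact hξ (f, f (s n)) (Submodule.mem_iSup_of_mem n ⟨hf, rfl⟩)

end Reflexive

end Matlis

namespace Matlis

/-! ### Idempotents and exchange in a ring that is a dual. -/

section Exchange

variable {A : Type u} [CommRing A] {T : Type v} [AddCommGroup T] [Module A T]
  {R : Type w} [Ring R]

/-- The elements of `R` whose associated functional extends the relation `G`. -/
def solutions (Φ : R ≃+ (T →ₗ[A] E A)) (G : Submodule A (T × E A)) : Set R :=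
  {x | ∀ p ∈ G, Φ x p.1 = p.2}

variable {Φ : R ≃+ (T →ₗ[A] E A)}

theorem mem_solutions_sup {G H : Submodule A (T × E A)} {x : R} :
    x ∈ solutions Φ (G ⊔ H) ↔ x ∈ solutions Φ G ∧ x ∈ solutions Φ H := by
  refine ⟨fun h ↦ ⟨fun p hp ↦ h p (Submodule.mem_sup_left hp),
    fun p hp ↦ h p (Submodule.mem_sup_right hp)⟩, fun h p hp ↦ ?_⟩
  obtain ⟨y, hy, z, hz, rfl⟩ := Submodule.mem_sup.1 hp
  rw [Prod.fst_add, Prod.snd_add, map_add, h.1 y hy, h.2 z hz]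

theorem solutions_anti {G H : Submodule A (T × E A)} (h : G ≤ H) :
    solutions Φ H ⊆ solutions Φ G := fun _ hx p hp ↦ hx p (h hp)

variable {γ : R → T →ₗ[A] T}

/-- Right multiplication by `c` is dual to `γ c`, and injectivity of `E` makes the image of a
solution set again a solution set: the analogue of a continuous image of a compact set being closed.
-/
theorem mem_solutions_comap (hγ : ∀ x c t, Φ (x * c) t = Φ x (γ c t))
    {G : Submodule A (T × E A)} {c y : R} :
    y ∈ solutions Φ (G.comap ((γ c).prodMap LinearMap.id)) ↔ ∃ x ∈ solutions Φ G, x * c = y := by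
  constructor
  · intro hy
    obtain ⟨φ, hφ⟩ := exists_linearMap_of_graph (G ⊔ LinearMap.range ((γ c).prod (Φ y))) (by
      intro e he
      obtain ⟨⟨t, a⟩, hp, q, ⟨r, rfl⟩, hpq⟩ := Submodule.mem_sup.1 he
      obtain ⟨h1, rfl⟩ := Prod.ext_iff.1 hpq
      have h1 : t + γ c r = 0 := h1
      have h2 : Φ y (-r) = a := hy (-r, a) (by
        rw [Submodule.mem_comap]
        change (γ c (-r), a) ∈ G
        rwa [map_neg, ← eq_neg_of_add_eq_zero_left h1])
      change a + Φ y r = 0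
      rw [← h2, map_neg, neg_add_cancel])
    refine ⟨Φ.symm φ, fun p hp ↦ ?_, Φ.injective (LinearMap.ext fun t ↦ ?_)⟩
    · rw [Φ.apply_symm_apply]
      exact hφ p (Submodule.mem_sup_left hp)
    · rw [hγ, Φ.apply_symm_apply]
      exact hφ (γ c t, Φ y t) (Submodule.mem_sup_right ⟨t, rfl⟩)
  · rintro ⟨x, hx, rfl⟩ p hp
    rw [hγ]
    exact hx _ hp

/-- An analogue of the Ellis–Numakura lemma for affine subsemigroups of a ring which is a dual. -/
theorem exists_idempotent_of_mul_mem (hγ : ∀ x c t, Φ (x * c) t = Φ x (γ c t))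
    {G : Submodule A (T × E A)} (hne : (solutions Φ G).Nonempty)
    (hmul : ∀ x ∈ solutions Φ G, ∀ y ∈ solutions Φ G, x * y ∈ solutions Φ G) :
    ∃ e ∈ solutions Φ G, e * e = e := by
  -- A maximal relation gives a minimal nonempty multiplicatively closed solution set. Along a chain
  -- nonemptiness survives because the union of the relations is still single-valued at 0.
  obtain ⟨H, hGH, hH⟩ := zorn_le_nonempty₀ {G : Submodule A (T × E A) |
      (solutions Φ G).Nonempty ∧
        ∀ x ∈ solutions Φ G, ∀ y ∈ solutions Φ G, x * y ∈ solutions Φ G} (by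
    intro S hS hchain H₀ hH₀
    have hmem : ∀ p ∈ sSup S, ∃ H ∈ S, p ∈ H := fun p hp ↦
      (Submodule.mem_sSup_of_directed ⟨H₀, hH₀⟩ hchain.directedOn).1 hp
    refine ⟨sSup S, ⟨?_, fun x hx y hy p hp ↦ ?_⟩, fun H hH ↦ le_sSup hH⟩
    · obtain ⟨φ, hφ⟩ := exists_linearMap_of_graph (sSup S) fun e he ↦ by
        obtain ⟨H, hH, heH⟩ := hmem _ he
        obtain ⟨x, hx⟩ := (hS hH).1
        exact (hx _ heH).symm.trans (map_zero _)
      exact ⟨Φ.symm φ, fun p hp ↦ by rw [Φ.apply_symm_apply]; exact hφ p hp⟩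
    · obtain ⟨H, hH, hpH⟩ := hmem _ hp
      exact (hS hH).2 x (solutions_anti (le_sSup hH) hx) y (solutions_anti (le_sSup hH) hy) p hpH)
    G ⟨hne, hmul⟩
  obtain ⟨⟨c, hc⟩, hHmul⟩ := hH.prop
  have hmax : ∀ K : Submodule A (T × E A), (solutions Φ (H ⊔ K)).Nonempty →
      (∀ x ∈ solutions Φ (H ⊔ K), ∀ y ∈ solutions Φ (H ⊔ K), x * y ∈ solutions Φ (H ⊔ K)) →
      c ∈ solutions Φ K := fun K h1 h2 ↦
    (mem_solutions_sup.1 (solutions_anti (hH.2 (y := H ⊔ K) ⟨h1, h2⟩ le_sup_left) hc)).2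
  -- With `S` the minimal set, `S ∩ S * c` contains `c * c` and is multiplicatively closed, so it
  -- contains `c`. Hence the stabiliser `{y ∈ S | y * c = c}` is nonempty, and minimality applied to
  -- it gives `c * c = c`.
  obtain ⟨x, hx, hxc⟩ := (mem_solutions_comap hγ).1 (hmax (H.comap ((γ c).prodMap LinearMap.id))
    ⟨c * c, mem_solutions_sup.2 ⟨hHmul c hc c hc, (mem_solutions_comap hγ).2 ⟨c, hc, rfl⟩⟩⟩ (by
      intro x hx y hy
      rw [mem_solutions_sup] at hx hy ⊢
      obtain ⟨z, hz, rfl⟩ := (mem_solutions_comap hγ).1 hy.2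
      exact ⟨hHmul _ hx.1 _ hy.1,
        (mem_solutions_comap hγ).2 ⟨x * z, hHmul _ hx.1 _ hz, mul_assoc x z c⟩⟩))
  have hfix : ∀ y, y ∈ solutions Φ (LinearMap.range ((γ c).prod (Φ c))) ↔ y * c = c := fun y ↦ by
    constructor
    · intro hy
      refine Φ.injective (LinearMap.ext fun t ↦ ?_)
      rw [hγ]
      exact hy _ ⟨t, rfl⟩
    · rintro hy p ⟨t, rfl⟩
      change Φ y (γ c t) = Φ c t
      rw [← hγ, hy]
  refine ⟨c, solutions_anti hGH hc, (hfix c).1 (hmax _ ⟨x, ?_⟩ ?_)⟩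
  · exact mem_solutions_sup.2 ⟨hx, (hfix x).2 hxc⟩
  · intro y hy z hz
    rw [mem_solutions_sup, hfix] at hy hz ⊢
    exact ⟨hHmul _ hy.1 _ hz.1, by rw [mul_assoc, hz.2, hy.2]⟩

/-- A ring which is a dual has the exchange property. -/
theorem exists_idempotent_mul (hγ : ∀ x c t, Φ (x * c) t = Φ x (γ c t)) (s : R) :
    ∃ e x y : R, e * e = e ∧ e = x * s ∧ 1 - e = y * (1 - s) := by
  -- `ρ` encodes the reflection `z ↦ 1 - z`. It lets `Rs ∩ (1 - R(1 - s))`, which contains `s`, be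
  -- written as a solution set; an idempotent in it is what is sought.
  let ρ : (T × E A) →ₗ[A] T × E A :=
    (LinearMap.fst A T (E A)).prod (Φ 1 ∘ₗ LinearMap.fst A T (E A) - LinearMap.snd A T (E A))
  have hmem : ∀ c y, y ∈ solutions Φ ((⊥ : Submodule A (T × E A)).comap
      ((γ c).prodMap LinearMap.id)) ↔ ∃ x, x * c = y := fun c y ↦ by
    rw [mem_solutions_comap hγ]
    refine exists_congr fun x ↦ and_iff_right fun p hp ↦ ?_
    rw [(Submodule.mem_bot A).1 hp]
    exact map_zero _
  have hρ : ∀ (H : Submodule A (T × E A)) (x : R),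
      x ∈ solutions Φ (H.map ρ) ↔ 1 - x ∈ solutions Φ H := fun H x ↦ by
    have key : ∀ p : T × E A, Φ x p.1 = Φ 1 p.1 - p.2 ↔ Φ (1 - x) p.1 = p.2 := fun p ↦ by
      rw [map_sub, LinearMap.sub_apply, sub_eq_iff_eq_add, eq_sub_iff_add_eq, eq_comm, add_comm]
    constructor
    · exact fun h p hp ↦ (key p).1 (h _ ⟨p, hp, rfl⟩)
    · rintro h _ ⟨p, hp, rfl⟩
      exact (key p).2 (h p hp)
  let H : R → Submodule A (T × E A) := fun c ↦ Submodule.comap ((γ c).prodMap LinearMap.id) ⊥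
  have hC : ∀ z, z ∈ solutions Φ (H s ⊔ (H (1 - s)).map ρ) ↔
      (∃ x, x * s = z) ∧ ∃ y, y * (1 - s) = 1 - z := fun z ↦ by
    rw [mem_solutions_sup, hρ, hmem, hmem]
  obtain ⟨e, he, hee⟩ := exists_idempotent_of_mul_mem hγ
    (G := H s ⊔ (H (1 - s)).map ρ) ⟨s, (hC s).2 ⟨⟨1, one_mul s⟩, 1, one_mul _⟩⟩ (by
      intro x hx y hy
      rw [hC] at hx hy ⊢
      obtain ⟨-, b, hb⟩ := hx
      obtain ⟨⟨c, rfl⟩, d, hd⟩ := hy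
      -- The witness comes from `1 - x * y = (1 - y) + (1 - x) - (1 - x) * (1 - y)`.
      refine ⟨⟨x * c, mul_assoc x c s⟩, d + b - (1 - x) * d, ?_⟩
      rw [sub_mul, add_mul, mul_assoc, hd, hb]
      noncomm_ring)
  obtain ⟨⟨x, hx⟩, y, hy⟩ := (hC e).1 he
  exact ⟨e, x, y, hee, hx.symm, hy.symm⟩

/-- If `x * s = 1`, then `s * x` is a nonzero idempotent, hence 1, so left invertible elements are
units. Exchange applied to `s` makes `s` or `1 - s` left invertible. -/
theorem isLocalRing_of_idempotent [Nontrivial R] (hγ : ∀ x c t, Φ (x * c) t = Φ x (γ c t))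
    (h : ∀ e : R, e * e = e → e = 0 ∨ e = 1) : IsLocalRing R := by
  have hunit : ∀ x s : R, x * s = 1 → IsUnit s := fun x s hxs ↦ by
    have h1 : s * x = 1 := by
      refine (h (s * x) ?_).resolve_left fun h0 ↦ ?_
      · rw [mul_assoc, ← mul_assoc x, hxs, one_mul]
      · apply one_ne_zero (α := R)
        calc (1 : R) = x * (s * x) * s := by rw [mul_assoc, mul_assoc, hxs, mul_one, hxs]
          _ = 0 := by rw [h0, mul_zero, zero_mul]
    exact ⟨⟨s, x, h1, hxs⟩, rfl⟩
  refine IsLocalRing.of_isUnit_or_isUnit_one_sub_self fun s ↦ ?_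
  obtain ⟨e, x, y, he, hx, hy⟩ := exists_idempotent_mul hγ s
  obtain rfl | rfl := h e he
  · exact Or.inr (hunit y _ (by rw [← hy, sub_zero]))
  · exact Or.inl (hunit x _ hx.symm)

end Exchange

/-! ### Endomorphism rings of reflexive modules as duals. -/

section End

variable {A : Type u} [CommRing A] {Λ : Type w} [Ring Λ] [Algebra A Λ]
  {M : Type v} [AddCommGroup M] [Module A M] [Module Λ M] [IsScalarTower A Λ M]

open TensorProduct

/-- The endomorphism ring of a reflexive module is a dual. -/
theorem EvaluationSurjective.exists_end_addEquiv (h : EvaluationSurjective A M) :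
    ∃ (T : Type (max u v)) (_ : AddCommGroup T) (_ : Module A T)
      (Φ : Module.End Λ M ≃+ (T →ₗ[A] E A)) (γ : Module.End Λ M → T →ₗ[A] T),
      ∀ x c t, Φ (x * c) t = Φ x (γ c t) := by
  let F := M →ₗ[A] E A
  let op : Λ → M →ₗ[A] M := fun a ↦ Algebra.lsmul A A M a
  -- The quotient by `W` is `M^∨ ⊗_Λ M`.
  let W : Submodule A (F ⊗[A] M) := Submodule.span A
    {t | ∃ (a : Λ) (f : F) (m : M), t = (f ∘ₗ op a) ⊗ₜ m - f ⊗ₜ (a • m)}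
  let Ψ : Module.End Λ M →+ (F ⊗[A] M →ₗ[A] E A) :=
    { toFun := fun x ↦ TensorProduct.lift (LinearMap.lcomp A (E A) (x.restrictScalars A))
      map_zero' := TensorProduct.ext' fun f m ↦ map_zero f
      map_add' := fun x y ↦ TensorProduct.ext' fun f m ↦ map_add f (x m) (y m) }
  have hΨ : ∀ x f m, Ψ x (f ⊗ₜ m) = f (x m) := fun x f m ↦ rfl
  have hW : ∀ x, W ≤ LinearMap.ker (Ψ x) := fun x ↦ by
    rw [Submodule.span_le]
    rintro _ ⟨a, f, m, rfl⟩
    change Ψ x _ = 0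
    rw [map_sub, hΨ, hΨ, map_smul]
    exact sub_self _
  have hγW : ∀ c : Module.End Λ M, W ≤ W.comap ((c.restrictScalars A).lTensor F) := fun c ↦ by
    rw [Submodule.span_le]
    rintro _ ⟨a, f, m, rfl⟩
    refine Submodule.subset_span ⟨a, f, c m, ?_⟩
    rw [map_sub, LinearMap.lTensor_tmul, LinearMap.lTensor_tmul]
    simp
  let Φ : Module.End Λ M →+ ((F ⊗[A] M) ⧸ W →ₗ[A] E A) :=
    { toFun := fun x ↦ W.liftQ (Ψ x) (hW x)
      map_zero' := Submodule.linearMap_qext _ (LinearMap.ext fun t ↦ by simp)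
      map_add' := fun x y ↦ Submodule.linearMap_qext _ (LinearMap.ext fun t ↦ by simp) }
  have hΦ : ∀ x f m, Φ x (W.mkQ (f ⊗ₜ m)) = f (x m) := fun x f m ↦ rfl
  have hsep : ∀ x y : M, (∀ f : F, f x = f y) → x = y := fun x y hxy ↦ by
    by_contra hne
    obtain ⟨f, hf⟩ := exists_apply_ne_zero (A := A) (sub_ne_zero.2 hne)
    exact hf (by rw [map_sub, hxy, sub_self])
  have hbij : Function.Bijective Φ := by
    constructor
    · refine fun x y hxy ↦ LinearMap.ext fun m ↦ hsep _ _ fun f ↦ ?_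
      rw [← hΦ, ← hΦ, hxy]
    · intro φ
      -- For fixed `m`, `f ↦ φ (f ⊗ m)` is evaluation at some `y` by reflexivity; `hsep` makes `y`
      -- unique, hence additive in `m`, and the relations in `W` make it `Λ`-linear.
      have hex : ∀ m : M, ∃ y : M, ∀ f : F, φ (W.mkQ (f ⊗ₜ m)) = f y := fun m ↦
        h (φ ∘ₗ W.mkQ ∘ₗ (TensorProduct.mk A F M).flip m)
      choose y hy using hex
      refine ⟨{ toFun := y, map_add' := fun m n ↦ hsep _ _ fun f ↦ ?_,
                map_smul' := fun a m ↦ hsep _ _ fun f ↦ ?_ }, ?_⟩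
      · rw [map_add, ← hy, ← hy, ← hy, TensorProduct.tmul_add, map_add, map_add]
      · have h1 : W.mkQ ((f ∘ₗ op a) ⊗ₜ m) = W.mkQ (f ⊗ₜ (a • m)) :=
          (Submodule.Quotient.eq W).2 (Submodule.subset_span ⟨a, f, m, rfl⟩)
        rw [← hy, ← h1, hy]
        rfl
      · refine Submodule.linearMap_qext _ (TensorProduct.ext' fun f m ↦ ?_)
        exact (hy m f).symm
  refine ⟨_, _, _, AddEquiv.ofBijective Φ hbij,
    fun c ↦ W.mapQ W ((c.restrictScalars A).lTensor F) (hγW c), fun x c t ↦ ?_⟩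
  suffices Φ (x * c) = Φ x ∘ₗ W.mapQ W ((c.restrictScalars A).lTensor F) (hγW c) from
    LinearMap.congr_fun this t
  exact Submodule.linearMap_qext _ (TensorProduct.ext' fun f m ↦ rfl)

theorem EvaluationSurjective.isLocalRing_end [Nontrivial M] (hM : EvaluationSurjective A M)
    (h : ∀ e : Module.End Λ M, e * e = e → e = 0 ∨ e = 1) : IsLocalRing (Module.End Λ M) := by
  obtain ⟨T, _, _, Φ, γ, hγ⟩ := hM.exists_end_addEquiv (Λ := Λ)
  exact isLocalRing_of_idempotent hγ h

end End

end Matlis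

/-! ### Decompositions in preadditive categories -/

section Decomposition

theorem exists_isUnit_of_isUnit_sum {R : Type*} [Ring R] [IsLocalRing R] {ι : Type*}
    (s : Finset ι) (f : ι → R) (h : IsUnit (∑ i ∈ s, f i)) : ∃ i ∈ s, IsUnit (f i) := by
  classical
  induction s using Finset.induction_on with
  | empty => simp at h
  | insert a s ha ih =>
    rw [Finset.sum_insert ha] at h
    obtain ⟨u, hu⟩ := h
    have h1 : ↑u⁻¹ * f a + ↑u⁻¹ * ∑ i ∈ s, f i = 1 := by
      rw [← mul_add, ← hu, Units.inv_mul]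
    obtain h2 | h2 := IsLocalRing.isUnit_or_isUnit_of_add_one h1
    · exact ⟨a, Finset.mem_insert_self a s, (Units.isUnit_units_mul _ _).1 h2⟩
    · obtain ⟨i, hi, hfi⟩ := ih ((Units.isUnit_units_mul _ _).1 h2)
      exact ⟨i, Finset.mem_insert_of_mem hi, hfi⟩

theorem IsLocalRing.eq_zero_or_eq_one_of_mul_self {R : Type*} [Ring R] [IsLocalRing R] {e : R}
    (he : e * e = e) : e = 0 ∨ e = 1 := by
  obtain h | h := IsLocalRing.isUnit_or_isUnit_of_add_one (sub_add_cancel 1 e)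
  · exact Or.inl (h.mul_right_eq_zero.1 (by rw [sub_mul, one_mul, he, sub_self]))
  · exact Or.inr (h.mul_left_cancel (by rw [he, mul_one]))

/-- A composite `X ⟶ Y ⟶ X` which is invertible has invertible first factor if `End Y` is local. -/
theorem isIso_of_isIso_comp {C : Type u} [Category.{v} C] [Preadditive C] {X Y : C} [IsLocalRing (End X)] [IsLocalRing (End Y)] (f : X ⟶ Y)
    (g : Y ⟶ X) [IsIso (f ≫ g)] : IsIso f := by
  let p : Y ⟶ X := g ≫ inv (f ≫ g)
  have hfp : f ≫ p = 𝟙 X := by rw [← Category.assoc, IsIso.hom_inv_id]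
  obtain h | h := IsLocalRing.eq_zero_or_eq_one_of_mul_self (R := End Y) (e := p ≫ f) (by
    change (p ≫ f) ≫ p ≫ f = p ≫ f
    rw [Category.assoc, reassoc_of% hfp])
  · have h0 : (1 : End X) = 0 := by
      change 𝟙 X = 0
      have h : p ≫ f = 0 := h
      rw [← Category.comp_id (𝟙 X), ← hfp, Category.assoc, reassoc_of% h, zero_comp, comp_zero]
    exact absurd h0 one_ne_zero
  · exact ⟨p, hfp, h⟩

variable {C : Type u} [Category.{v} C] [Preadditive C] [HasFiniteBiproducts C]
  [HasBinaryBiproducts C]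

/-- Splitting off one summand of a finite biproduct. -/
noncomputable def biproductFinSuccAboveIso {n : ℕ} (Y : Fin (n + 1) → C) (j : Fin (n + 1)) :
    ⨁ Y ≅ Y j ⊞ ⨁ fun k ↦ Y (j.succAbove k) where
  hom := biprod.lift (biproduct.π Y j) (biproduct.lift fun k ↦ biproduct.π Y (j.succAbove k))
  inv := biprod.desc (biproduct.ι Y j) (biproduct.desc fun k ↦ biproduct.ι Y (j.succAbove k))
  hom_inv_id := by
    rw [biprod.lift_desc, biproduct.lift_desc, ← biproduct.total, Fin.sum_univ_succAbove _ j]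
  inv_hom_id := by
    ext k
    · simp
    · simp [biproduct.ι_π_ne _ (Fin.succAbove_ne j _).symm]
    · simp [biproduct.ι_π_ne _ (Fin.succAbove_ne j _)]
    · rename_i l
      by_cases hkl : k = l
      · subst hkl
        simp
      · simp [biproduct.ι_π_ne _ hkl,
          biproduct.ι_π_ne _ (fun h ↦ hkl (Fin.succAbove_right_injective h))]

/-- The Krull–Remak–Schmidt–Azumaya theorem: uniqueness of decompositions into objects with local
endomorphism rings. -/
theorem exists_equiv_of_biproduct_iso : ∀ {m n : ℕ} (Y : Fin m → C) (Z : Fin n → C),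
    (∀ i, IsLocalRing (End (Y i))) → (∀ j, IsLocalRing (End (Z j))) → (⨁ Y ≅ ⨁ Z) →
    ∃ σ : Fin m ≃ Fin n, ∀ i, Nonempty (Y i ≅ Z (σ i))
  | 0, 0, _, _, _, _, _ => ⟨Equiv.refl _, fun i ↦ i.elim0⟩
  | 0, n + 1, Y, Z, _, hZ, e => by
    have := hZ 0
    have h0 : (1 : End (Z 0)) = 0 := by
      change 𝟙 (Z 0) = 0
      have : e.inv = 0 := biproduct.hom_ext _ _ fun i ↦ i.elim0
      rw [← biproduct.ι_π_self Z 0, ← Category.id_comp (biproduct.π Z 0), ← e.inv_hom_id, this]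
      simp
    exact absurd h0 one_ne_zero
  | m + 1, 0, Y, Z, hY, _, e => by
    have := hY 0
    have h0 : (1 : End (Y 0)) = 0 := by
      change 𝟙 (Y 0) = 0
      have : e.hom = 0 := biproduct.hom_ext _ _ fun i ↦ i.elim0
      rw [← biproduct.ι_π_self Y 0, ← Category.id_comp (biproduct.π Y 0), ← e.hom_inv_id, this]
      simp
    exact absurd h0 one_ne_zero
  | m + 1, n + 1, Y, Z, hY, hZ, e => by
    have := hY 0
    have hsum : ∑ j, (biproduct.ι Y 0 ≫ e.hom ≫ biproduct.π Z j) ≫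
        (biproduct.ι Z j ≫ e.inv ≫ biproduct.π Y 0) = 𝟙 (Y 0) := by
      have h1 : ∀ j, (biproduct.ι Y 0 ≫ e.hom ≫ biproduct.π Z j) ≫
          (biproduct.ι Z j ≫ e.inv ≫ biproduct.π Y 0) = (biproduct.ι Y 0 ≫ e.hom) ≫
          (biproduct.π Z j ≫ biproduct.ι Z j) ≫ e.inv ≫ biproduct.π Y 0 := fun j ↦ by
        simp only [Category.assoc]
      simp_rw [h1]
      rw [← Preadditive.comp_sum, ← Preadditive.sum_comp, biproduct.total]
      simp
    -- The identity of `Y 0` is a sum of composites through the `Z j`; locality makes one of them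
    -- invertible, so `Y 0` is isomorphic to that `Z j`.
    obtain ⟨j, -, hj⟩ := exists_isUnit_of_isUnit_sum (R := End (Y 0)) Finset.univ
      (fun j ↦ (biproduct.ι Y 0 ≫ e.hom ≫ biproduct.π Z j) ≫
        (biproduct.ι Z j ≫ e.inv ≫ biproduct.π Y 0)) (by
          rw [show ∑ j, _ = (1 : End (Y 0)) from hsum]
          exact isUnit_one)
    have := hZ j
    have hiso : IsIso ((biproduct.ι Y 0 ≫ e.hom ≫ biproduct.π Z j) ≫
        (biproduct.ι Z j ≫ e.inv ≫ biproduct.π Y 0)) := (isUnit_iff_isIso _).1 hj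
    have hf := isIso_of_isIso_comp (biproduct.ι Y 0 ≫ e.hom ≫ biproduct.π Z j)
      (biproduct.ι Z j ≫ e.inv ≫ biproduct.π Y 0)
    let e' : Y 0 ⊞ (⨁ fun k ↦ Y (Fin.succAbove 0 k)) ≅ Z j ⊞ ⨁ fun k ↦ Z (j.succAbove k) :=
      (biproductFinSuccAboveIso Y 0).symm ≪≫ e ≪≫ biproductFinSuccAboveIso Z j
    have hf' : IsIso (biprod.inl ≫ e'.hom ≫ biprod.fst) := by
      simpa only [e', biproductFinSuccAboveIso, Iso.trans_hom, Iso.symm_hom, Category.assoc,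
        biprod.lift_fst, biprod.inl_desc_assoc] using hf
    -- Gaussian elimination on the invertible corner of `e'` leaves an isomorphism between the
    -- complements, to which induction applies.
    obtain ⟨σ, hσ⟩ := exists_equiv_of_biproduct_iso _ _ (fun i ↦ hY _) (fun i ↦ hZ _)
      (Biprod.isoElim e')
    refine ⟨((finSuccEquiv' 0).trans (Equiv.optionCongr σ)).trans (finSuccEquiv' j).symm,
      fun i ↦ ?_⟩
    obtain rfl | ⟨k, rfl⟩ := Fin.eq_self_or_eq_succAbove 0 i
    · simpa using ⟨asIso (biproduct.ι Y 0 ≫ e.hom ≫ biproduct.π Z j)⟩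
    · simpa only [Equiv.trans_apply, finSuccEquiv'_succAbove, Equiv.optionCongr_apply,
        Option.map_some, finSuccEquiv'_symm_some] using hσ k

end Decomposition

/-! ### Decompositions of modules -/

section ModuleDecomposition

variable {Λ : Type w} [Ring Λ]

/-- The object is a finite biproduct of indecomposable objects. -/
def HasFiniteDecomposition (X : ModuleCat.{v} Λ) : Prop :=
  ∃ (n : ℕ) (Y : Fin n → ModuleCat.{v} Λ), Nonempty (X ≅ ⨁ Y) ∧ ∀ i, Indecomposable (Y i)

theorem HasFiniteDecomposition.of_iso {X Y : ModuleCat.{v} Λ} (e : X ≅ Y)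
    (h : HasFiniteDecomposition X) : HasFiniteDecomposition Y := by
  obtain ⟨n, Z, ⟨f⟩, hZ⟩ := h
  exact ⟨n, Z, ⟨e.symm ≪≫ f⟩, hZ⟩

theorem HasFiniteDecomposition.biprod {X Y : ModuleCat.{v} Λ}
    (hX : HasFiniteDecomposition X) (hY : HasFiniteDecomposition Y) :
    HasFiniteDecomposition (X ⊞ Y) := by
  obtain ⟨m, Z, ⟨e⟩, hZ⟩ := hX
  obtain ⟨n, W, ⟨f⟩, hW⟩ := hY
  let V : Fin m ⊕ Fin n → ModuleCat.{v} Λ := Sum.elim Z W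
  have g : (⨁ Z) ⊞ (⨁ W) ≅ ⨁ V :=
    ModuleCat.biprodIsoProd _ _ ≪≫
      ((ModuleCat.biproductIsoPi Z).toLinearEquiv.prodCongr
        (ModuleCat.biproductIsoPi W).toLinearEquiv).toModuleIso ≪≫
      (LinearEquiv.sumPiEquivProdPi Λ (Fin m) (Fin n) fun i ↦ V i).symm.toModuleIso ≪≫
      (ModuleCat.biproductIsoPi V).symm
  refine ⟨m + n, fun i ↦ V (finSumFinEquiv.symm i), ⟨biprod.mapIso e f ≪≫ g ≪≫
    biproduct.whiskerEquiv finSumFinEquiv fun i ↦ eqToIso (by simp)⟩, fun i ↦ ?_⟩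
  have hV : ∀ j, Indecomposable (V j) := Sum.rec hZ hW
  exact hV _

theorem hasFiniteDecomposition_of_isZero {X : ModuleCat.{v} Λ} (hX : IsZero X) :
    HasFiniteDecomposition X := by
  refine ⟨0, Fin.elim0, ⟨hX.iso ?_⟩, fun i ↦ i.elim0⟩
  rw [IsZero.iff_id_eq_zero]
  ext i
  exact i.elim0

theorem hasFiniteDecomposition_of_indecomposable {X : ModuleCat.{v} Λ} (hX : Indecomposable X) :
    HasFiniteDecomposition X :=
  ⟨1, fun _ ↦ X, ⟨(biproductUniqueIso fun _ : Fin 1 ↦ X).symm⟩, fun _ ↦ hX⟩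

/-- If both summands decomposed finitely, so would `X`. The bad summand can therefore be split
again, leaving a nonzero piece each time. -/
theorem exists_biprod_of_not_hasFiniteDecomposition {X : ModuleCat.{v} Λ}
    (hX : ¬ HasFiniteDecomposition X) : ∃ Y Z : ModuleCat.{v} Λ,
      Nonempty (X ≅ Y ⊞ Z) ∧ ¬ IsZero Y ∧ ¬ HasFiniteDecomposition Z := by
  have h1 : ¬ Indecomposable X := fun h ↦ hX (hasFiniteDecomposition_of_indecomposable h)
  have h2 : ¬ IsZero X := fun h ↦ hX (hasFiniteDecomposition_of_isZero h)
  unfold Indecomposable at h1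
  push Not at h1
  obtain ⟨Y, Z, e, hY, hZ⟩ := h1 h2
  by_cases h : HasFiniteDecomposition Z
  · exact ⟨Z, Y, ⟨e ≪≫ biprod.braiding Y Z⟩, hZ, fun h' ↦ hX ((h'.biprod h).of_iso e.symm)⟩
  · exact ⟨Y, Z, ⟨e⟩, hY, h⟩

theorem exists_submodules_of_not_hasFiniteDecomposition {M : ModuleCat.{v} Λ} (N : Submodule Λ M)
    (hN : ¬ HasFiniteDecomposition (ModuleCat.of Λ N)) :
    ∃ L N' : Submodule Λ M, L ≤ N ∧ N' ≤ N ∧ Disjoint L N' ∧ L ≠ ⊥ ∧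
      ¬ HasFiniteDecomposition (ModuleCat.of Λ N') := by
  obtain ⟨Y, Z, ⟨e⟩, hY, hZ⟩ := exists_biprod_of_not_hasFiniteDecomposition hN
  let φ : (Y × Z) ≃ₗ[Λ] N := (e ≪≫ ModuleCat.biprodIsoProd Y Z).symm.toLinearEquiv
  let ψ : (Y × Z) →ₗ[Λ] M := N.subtype ∘ₗ φ.toLinearMap
  have hψ : Function.Injective ψ := N.injective_subtype.comp φ.injective
  refine ⟨LinearMap.range (ψ ∘ₗ LinearMap.inl Λ Y Z), LinearMap.range (ψ ∘ₗ LinearMap.inr Λ Y Z),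
    ?_, ?_, ?_, fun h ↦ hY ?_, fun h ↦ hZ (h.of_iso ?_)⟩
  · rintro _ ⟨y, rfl⟩
    exact (φ (y, 0)).2
  · rintro _ ⟨z, rfl⟩
    exact (φ (0, z)).2
  · rw [Submodule.disjoint_def]
    rintro _ ⟨y, rfl⟩ ⟨z, hz⟩
    have h1 : (0, z) = (y, 0) := hψ hz
    obtain rfl : 0 = y := congrArg Prod.fst h1
    exact map_zero _
  · rw [LinearMap.range_eq_bot] at h
    have : Subsingleton Y := ⟨fun y y' ↦ by
      have : ψ (y, 0) = ψ (y', 0) :=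
        (LinearMap.congr_fun h y).trans (LinearMap.congr_fun h y').symm
      exact congrArg Prod.fst (hψ this)⟩
    exact ModuleCat.isZero_of_subsingleton Y
  · exact (LinearEquiv.ofInjective (ψ ∘ₗ LinearMap.inr Λ Y Z)
      (hψ.comp LinearMap.inr_injective)).symm.toModuleIso

end ModuleDecomposition

namespace Matlis

/-! ### Finite decompositions, local endomorphism rings and the Serre property. -/

section

variable {A : Type u} [CommRing A] {Λ : Type w} [Ring Λ] [Algebra A Λ]

theorem EvaluationSurjective.hasFiniteDecomposition {M : ModuleCat.{v} Λ} [Module A M]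
    [IsScalarTower A Λ M] (h : EvaluationSurjective A M) : HasFiniteDecomposition M := by
  by_contra hM
  choose L' N' hL' hN' hdisj' hbot' hbad' using
    exists_submodules_of_not_hasFiniteDecomposition (M := M)
  let B := {N : Submodule Λ M // ¬ HasFiniteDecomposition (ModuleCat.of Λ N)}
  -- Splitting forever gives independent nonzero `L n` with `L n ⊕ N (n + 1)` inside `N n`, starting
  -- from `N 0 = ⊤`.
  let S : ℕ → B := fun n ↦ Nat.rec
    ⟨⊤, fun h ↦ hM (h.of_iso (Submodule.topEquiv (R := Λ) (M := M)).toModuleIso)⟩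
    (fun _ P ↦ ⟨N' P.1 P.2, hbad' P.1 P.2⟩) n
  let N : ℕ → Submodule Λ M := fun n ↦ (S n).1
  let L : ℕ → Submodule Λ M := fun n ↦ L' (S n).1 (S n).2
  have hLN : ∀ n, L n ≤ N n := fun n ↦ hL' _ _
  have hN : Antitone N := antitone_nat_of_succ_le fun n ↦ hN' (S n).1 (S n).2
  have hdisj : ∀ n, Disjoint (L n) (N (n + 1)) := fun n ↦ hdisj' (S n).1 (S n).2
  have hl : ∀ n, ∃ l ∈ L n, l ≠ 0 := fun n ↦ (Submodule.ne_bot_iff _).1 (hbot' _ _)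
  choose l hl hl0 using hl
  let F : ℕ → Submodule Λ M := fun n ↦ ⨆ k : Set.Iio n, L k
  -- Linear compactness is applied to the tails `V n` rather than to `N n`: this puts the limit `x`
  -- of the sums `s n` in `V 0`, hence in some `F m`. There `x - s m` lies in `F m ∩ N m = 0`, so
  -- `-l m = x - s (m + 1)` lies in `N (m + 1)`, against `l m ≠ 0`.
  let V : ℕ → Submodule Λ M := fun n ↦ ⨆ k : Set.Ici n, L k
  have hFmono : Monotone F := fun m n hmn ↦ iSup_le fun k ↦
    le_iSup (fun k : Set.Iio n ↦ L k) ⟨k, lt_of_lt_of_le k.2 hmn⟩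
  have hLF : ∀ n, L n ≤ F (n + 1) := fun n ↦
    le_iSup (fun k : Set.Iio (n + 1) ↦ L k) ⟨n, Nat.lt_succ_self n⟩
  have hFsucc : ∀ n, F (n + 1) ≤ F n ⊔ L n := fun n ↦ iSup_le fun ⟨k, hk⟩ ↦ by
    obtain h | rfl := Nat.lt_succ_iff_lt_or_eq.1 hk
    · exact (le_iSup (fun k : Set.Iio n ↦ L k) ⟨k, h⟩).trans le_sup_left
    · exact le_sup_right
  have hLV : ∀ m n, m ≤ n → L n ≤ V m := fun m n h ↦ le_iSup (fun k : Set.Ici m ↦ L k) ⟨n, h⟩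
  have hVanti : Antitone V := fun m n hmn ↦ iSup_le fun k ↦ hLV m k (hmn.trans k.2)
  have hVN : ∀ n, V n ≤ N n := fun n ↦ iSup_le fun k ↦ (hLN k).trans (hN k.2)
  have hFN : ∀ n, Disjoint (F n) (N n) := fun n ↦ by
    induction n with
    | zero =>
      have : F 0 = ⊥ := le_bot_iff.1 (iSup_le fun k ↦ absurd k.2 (Nat.not_lt_zero _))
      rw [this]
      exact disjoint_bot_left
    | succ n ih =>
      rw [Submodule.disjoint_def] at ih ⊢
      intro x hx hxN
      obtain ⟨a, ha, b, hb, rfl⟩ := Submodule.mem_sup.1 (hFsucc n hx)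
      have ha0 : a = 0 := ih a ha (by
        have := (N n).sub_mem (hN n.le_succ hxN) (hLN n hb)
        rwa [add_sub_cancel_right] at this)
      rw [ha0, zero_add] at hxN ⊢
      exact (Submodule.disjoint_def.1 (hdisj n)) b hb hxN
  let s : ℕ → M := fun n ↦ ∑ k ∈ Finset.range n, l k
  have hs : ∀ m n, m ≤ n → s n - s m ∈ V m := fun m n hmn ↦ by
    rw [← Finset.sum_Ico_eq_sub _ hmn]
    exact Submodule.sum_mem _ fun k hk ↦ hLV m k (Finset.mem_Ico.1 hk).1 (hl k)
  obtain ⟨x, hx⟩ := h.exists_sub_mem (fun n ↦ (V n).restrictScalars A)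
    (fun m n hmn ↦ hVanti hmn) s hs
  have hxF : x ∈ ⨆ n, F n := by
    have h0 : x ∈ V 0 := by simpa [s] using hx 0
    exact (iSup_le fun k : Set.Ici 0 ↦ (hLF k).trans (le_iSup F _) : V 0 ≤ ⨆ n, F n) h0
  obtain ⟨m, hm⟩ := (Submodule.mem_iSup_of_directed F hFmono.directed_le).1 hxF
  have hsF : s m ∈ F m := Submodule.sum_mem _ fun k hk ↦
    hFmono (Finset.mem_range.1 hk) (hLF k (hl k))
  have hxs : x - s m = 0 :=
    Submodule.disjoint_def.1 (hFN m) _ ((F m).sub_mem hm hsF) (hVN m (hx m))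
  have h1 : x - s (m + 1) ∈ N (m + 1) := hVN (m + 1) (hx (m + 1))
  have h2 : x - s (m + 1) = - l m := by
    have : s (m + 1) = s m + l m := Finset.sum_range_succ l m
    rw [this, ← sub_sub, hxs, zero_sub]
  rw [h2, Submodule.neg_mem_iff] at h1
  exact hl0 m (Submodule.disjoint_def.1 (hdisj m) _ (hl m) h1)

/-- An idempotent `e` splits `M` into range and kernel, so indecomposability forces `e = 0` or `e =
1`. -/
theorem EvaluationSurjective.isLocalRing_end_of_indecomposable {M : ModuleCat.{v} Λ} [Module A M]
    [IsScalarTower A Λ M] (h : EvaluationSurjective A M) (hM : Indecomposable M) :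
    IsLocalRing (End M) := by
  have hnt : Nontrivial M := not_subsingleton_iff_nontrivial.1 fun _ ↦
    hM.1 (ModuleCat.isZero_of_subsingleton M)
  have : IsLocalRing (Module.End Λ M) := h.isLocalRing_end fun e he ↦ by
    have hc := LinearMap.IsIdempotentElem.isCompl (f := e) he
    obtain h | h := hM.2 (ModuleCat.of Λ (LinearMap.range e)) (ModuleCat.of Λ (LinearMap.ker e))
      ((Submodule.prodEquivOfIsCompl _ _ hc).symm.toModuleIso ≪≫
        (ModuleCat.biprodIsoProd (ModuleCat.of Λ (LinearMap.range e))
          (ModuleCat.of Λ (LinearMap.ker e))).symm)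
    · have := ModuleCat.subsingleton_of_isZero h
      exact Or.inl (LinearMap.range_eq_bot.1 (Submodule.subsingleton_iff_eq_bot.1 this))
    · have := ModuleCat.subsingleton_of_isZero h
      have hinj := LinearMap.ker_eq_bot.1 (Submodule.subsingleton_iff_eq_bot.1 this)
      exact Or.inr (LinearMap.ext fun x ↦ hinj (LinearMap.congr_fun he x))
  let f := (ModuleCat.endRingEquiv M).symm
  have := f.symm.toEquiv.nontrivial
  exact IsLocalRing.of_isUnit_or_isUnit_one_sub_self fun a ↦ by
    have := (IsLocalRing.isUnit_or_isUnit_of_add_one (add_sub_cancel (f.symm a) 1)).imp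
      (fun h ↦ h.map f) (fun h ↦ h.map f)
    simpa using this

end

instance isSerreClass_reflexiveModules (A : Type u) [CommRing A] (Λ : Type w) [Ring Λ]
    [Algebra A Λ] : (reflexiveModules.{u, v, w} A Λ).IsSerreClass where
  exists_zero := by
    refine ⟨ModuleCat.of Λ PUnit.{v + 1}, ModuleCat.isZero_of_subsingleton _, isReflexive_iff.2 fun ξ ↦ ?_⟩
    refine ⟨PUnit.unit, fun f ↦ ?_⟩
    let : Module A PUnit.{v + 1} := Module.restrictScalars A Λ PUnit.{v + 1}
    have hf : f = 0 := LinearMap.ext fun x ↦ map_zero f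
    rw [hf, map_zero, LinearMap.zero_apply]
  prop_of_mono {X Y} f _ hY := by
    let : Module A X := Module.restrictScalars A Λ X
    have : IsScalarTower A Λ X := IsScalarTower.restrictScalars A Λ X
    let : Module A Y := Module.restrictScalars A Λ Y
    have : IsScalarTower A Λ Y := IsScalarTower.restrictScalars A Λ Y
    exact isReflexive_iff.2 ((isReflexive_iff.1 hY).of_injective (f.hom.restrictScalars A)
      ((ModuleCat.mono_iff_injective f).1 inferInstance))
  prop_of_epi {X Y} f _ hX := by
    let : Module A X := Module.restrictScalars A Λ X
    have : IsScalarTower A Λ X := IsScalarTower.restrictScalars A Λ X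
    let : Module A Y := Module.restrictScalars A Λ Y
    have : IsScalarTower A Λ Y := IsScalarTower.restrictScalars A Λ Y
    exact isReflexive_iff.2 ((isReflexive_iff.1 hX).of_surjective (f.hom.restrictScalars A)
      ((ModuleCat.epi_iff_surjective f).1 inferInstance))
  prop_X₂_of_shortExact {S} hS h₁ h₃ := by
    let : Module A S.X₁ := Module.restrictScalars A Λ S.X₁
    have : IsScalarTower A Λ S.X₁ := IsScalarTower.restrictScalars A Λ S.X₁
    let : Module A S.X₂ := Module.restrictScalars A Λ S.X₂
    have : IsScalarTower A Λ S.X₂ := IsScalarTower.restrictScalars A Λ S.X₂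
    let : Module A S.X₃ := Module.restrictScalars A Λ S.X₃
    have : IsScalarTower A Λ S.X₃ := IsScalarTower.restrictScalars A Λ S.X₃
    have := hS.epi_g
    exact isReflexive_iff.2 ((isReflexive_iff.1 h₁).of_exact (isReflexive_iff.1 h₃)
      (S.f.hom.restrictScalars A) (S.g.hom.restrictScalars A)
      ((ModuleCat.epi_iff_surjective S.g).1 inferInstance)
      ((ShortComplex.ShortExact.moduleCat_exact_iff_function_exact S).1 hS.exact))

section

variable {A : Type u} [CommRing A] {Λ : Type w} [Ring Λ] [Algebra A Λ]

theorem hasFiniteDecomposition_of_reflexiveModules {X : ModuleCat.{v} Λ}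
    (hX : reflexiveModules A Λ X) : HasFiniteDecomposition X := by
  let : Module A X := Module.restrictScalars A Λ X
  have : IsScalarTower A Λ X := IsScalarTower.restrictScalars A Λ X
  exact (isReflexive_iff.1 hX).hasFiniteDecomposition

theorem isLocalRing_end_of_reflexiveModules {X : ModuleCat.{v} Λ}
    (hX : reflexiveModules A Λ X) (h : Indecomposable X) : IsLocalRing (End X) := by
  let : Module A X := Module.restrictScalars A Λ X
  have : IsScalarTower A Λ X := IsScalarTower.restrictScalars A Λ X
  exact (isReflexive_iff.1 hX).isLocalRing_end_of_indecomposable h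

theorem reflexiveModules_of_iso_biproduct {X : ModuleCat.{v} Λ} (hX : reflexiveModules A Λ X)
    {n : ℕ} {Y : Fin n → ModuleCat.{v} Λ} (e : X ≅ ⨁ Y) (i : Fin n) :
    reflexiveModules A Λ (Y i) :=
  ObjectProperty.prop_of_mono _ (biproduct.ι Y i ≫ e.inv) hX

end

end Matlis

theorem mainTheorem5 (A : Type u) [CommRing A] (Λ : Type w) [Ring Λ] [Algebra A Λ] :
    (Matlis.reflexiveModules.{u, v, w} A Λ).IsSerreClass ∧
      IsKrullSchmidt (Matlis.reflexiveModules.{u, v, w} A Λ) := by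
  refine ⟨inferInstance, fun X hX ↦ ?_, fun X hX m n Y Z hY hZ ⟨e⟩ ⟨f⟩ ↦ ?_⟩
  · obtain ⟨n, Y, ⟨e⟩, hY⟩ := Matlis.hasFiniteDecomposition_of_reflexiveModules hX
    have hP := fun i ↦ Matlis.reflexiveModules_of_iso_biproduct hX e i
    exact ⟨n, Y, ⟨e⟩, fun i ↦
      ⟨hP i, hY i, Matlis.isLocalRing_end_of_reflexiveModules (hP i) (hY i)⟩⟩
  · exact exists_equiv_of_biproduct_iso Y Z
      (fun i ↦ Matlis.isLocalRing_end_of_reflexiveModules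
        (Matlis.reflexiveModules_of_iso_biproduct hX e i) (hY i))
      (fun i ↦ Matlis.isLocalRing_end_of_reflexiveModules
        (Matlis.reflexiveModules_of_iso_biproduct hX f i) (hZ i))
      (e.symm ≪≫ f)
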